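/- Let $\mathcal B=\{x\in\mathbb R^d:\|x\|\le 1\}$ denote the closed Euclidean unit ball. A random vector $a$ in $\mathbb R^d$ is called $\Sigma$-subgaussian, for a (symmetric) positive definite matrix $\Sigma\in\mathbb R^{d\times d}$, if $$\mathbb P(|a^\top x|>t)\le 2\exp\Big(-\frac12\,\frac{t^2}{x^\top\Sigma x}\Big)\qquad\text{for all } t>0,\ x\in\mathcal B .$$ Let $\sigma_1^2\ge\cdots\ge\sigma_d^2>0$ be the eigenvalues of $\Sigma$, with multiplicity, $\sigma_i>0$, and for every integer $r\ge1$ let $d_{\rm eff}(r)=\sum_{i=1}^d(\sigma_i/\sigma_1)^{2/r}$. There is a universal constant $c>0$ such that the following holds for every $d\ge2$, every positive definite $\Sigma\in\mathbb R^{d\times d}$, every $\Sigma$-subgaussian random vector $a\in\mathbb R^d$ and every $\varepsilon>0$. Put $m_\varepsilon=\sum_{i=1}^d\mathbf 1_{\sigma_i>\varepsilon\sigma_1}$ and $$\mathcal H_\varepsilon=\sum_{i=1}^{m_\varepsilon}\ln\Big(\frac{\sigma_i}{\varepsilon\sigma_1}\Big)+c\Big[\ln d+\sqrt{\ln(\varepsilon^{-1})\,\ln(d)\,m_\varepsilon}\Big]$$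 (the square root being $0$ when $m_\varepsilon=0$, in particular when $\varepsilon\ge1$). (i) There is a finite set $\mathcal N_\varepsilon\subset\mathcal B$ such that for all $x\in\mathcal B$ there is $y\in\mathcal N_\varepsilon$ with $$\|x-y\|_\Sigma^2:=(x-y)^\top\Sigma(x-y)\le\varepsilon^2\sigma_1^2,\qquad\text{and}\qquad \ln|\mathcal N_\varepsilon|\le\mathcal H_\varepsilon .$$ (ii) For every integer $r\ge1$, if $\varepsilon\le 1$ then $$\mathcal H_\varepsilon\le\ln(\varepsilon^{-1})+\frac{\min\Big(d-1,\ \varepsilon^{-2/r}\frac{d_{\rm eff}(r)-1}{e}\Big)}{2/r}\,\ln\Big(\max\Big(e,\ \varepsilon^{-2/r}\frac{d_{\rm eff}(r)-1}{d-1}\Big)\Big)+c\Big[\ln d+\sqrt{\ln(\varepsilon^{-1})\,\ln(d)\,m_\varepsilon}\Big].$$ (iii) For every integer $r\ge1$ (and every $\varepsilon>0$), $m_\varepsilon\le1+(d_{\rm eff}(r)-1)\,\varepsilon^{-2/r}$. -/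

import Mathlib

open MeasureTheory

noncomputable section

/-- The quadratic form `xᵀ S x`, i.e. the square of the `S`-norm of `x`. -/
def matrixNormSq {d : ℕ} (S : Matrix (Fin d) (Fin d) ℝ) (x : EuclideanSpace ℝ (Fin d)) : ℝ :=
  x.ofLp ⬝ᵥ S.mulVec x.ofLp

/-- A random vector `a` is `S`-subgaussian if `P(|aᵀx| > t) ≤ 2 exp(-t² / (2 xᵀSx))` for all
`t > 0` and all `x` in the closed unit ball. (At `x = 0` the inequality holds trivially.) -/
def IsMatrixSubgaussian {d : ℕ} {Ω : Type*} [MeasurableSpace Ω] (P : Measure Ω)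
    (S : Matrix (Fin d) (Fin d) ℝ) (a : Ω → EuclideanSpace ℝ (Fin d)) : Prop :=
  ∀ t : ℝ, 0 < t → ∀ x ∈ Metric.closedBall (0 : EuclideanSpace ℝ (Fin d)) 1,
    P.real {ω | t < |(a ω).ofLp ⬝ᵥ x.ofLp|} ≤
      2 * Real.exp (-(1 / 2) * (t ^ 2 / matrixNormSq S x))

/-- The numbers `σ₁ ≥ σ₂ ≥ ⋯ ≥ σ_d`, whose squares are the eigenvalues of the positive
semidefinite matrix `S`, repeated with multiplicity, in nonincreasing order.
The index set `Fin d` starts at `0`: `specScale hS 0` is `σ₁`. -/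
def specScale {d : ℕ} {S : Matrix (Fin d) (Fin d) ℝ} (hS : S.PosSemidef) (i : Fin d) : ℝ :=
  Real.sqrt (hS.isHermitian.eigenvalues₀ (Fin.cast (Fintype.card_fin d).symm i))

/-- The effective dimension `d_eff(r) = ∑ᵢ (σᵢ / σ₁)^(2/r)`. -/
def effDim {d : ℕ} [NeZero d] {S : Matrix (Fin d) (Fin d) ℝ} (hS : S.PosSemidef) (r : ℕ) : ℝ :=
  ∑ i : Fin d, (specScale hS i / specScale hS 0) ^ ((2 : ℝ) / (r : ℝ))

/-- `m_ε`, the number of indices `i` with `σᵢ > ε σ₁`. -/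
def largeCount {d : ℕ} [NeZero d] {S : Matrix (Fin d) (Fin d) ℝ} (hS : S.PosSemidef)
    (ε : ℝ) : ℕ :=
  Nat.card {i : Fin d // ε * specScale hS 0 < specScale hS i}

/-- The remainder term `c [ln d + √(ln(ε⁻¹) ln(d) m_ε)]`. -/
def entropyRemainder {d : ℕ} [NeZero d] {S : Matrix (Fin d) (Fin d) ℝ} (hS : S.PosSemidef)
    (c ε : ℝ) : ℝ :=
  c * (Real.log d + Real.sqrt (Real.log ε⁻¹ * Real.log d * (largeCount hS ε : ℝ)))

/-- `H_ε = ∑_{i ≤ m_ε} ln(σᵢ / (ε σ₁)) + c [ln d + √(ln(ε⁻¹) ln(d) m_ε)]`;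
the sum runs over the first `m_ε` indices. -/
def entropyBound {d : ℕ} [NeZero d] {S : Matrix (Fin d) (Fin d) ℝ} (hS : S.PosSemidef)
    (c ε : ℝ) : ℝ :=
  (∑ i ∈ Finset.univ.filter (fun i : Fin d => i.val < largeCount hS ε),
      Real.log (specScale hS i / (ε * specScale hS 0))) + entropyRemainder hS c ε

end

/-!
In the eigenbasis of `S` the net becomes a cover of the ellipsoid with semi-axes `σᵢ` by balls of
radius `ε σ₁`. Group the axes into blocks on which `log⁺ (σᵢ / (ε σ₁))` varies by at most `h` and
round every semi-axis up to the largest length in its block: the ellipsoid then lies in a union of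
products of balls, one for each block and each profile of block norms, and these profiles only need
to be resolved up to an error of order `1 / d²`. Within a block of dimension `n`, a ball of radius
`b` is covered by polynomially many times `(b / e)ⁿ` balls of radius `e`: for `δ ≤ 1`, a random
point of the ball of radius `√(1 - δ²)` lies within `δ` of a given point of the unit ball with
probability at least `δⁿ` up to a polynomial factor in `n`, because the lens of such points contains
a half of a ball of radius almost `δ √(1 - δ²)`, and a greedy choice of centers turns such a
probability bound into a cover. With `L = log ε⁻¹` there are `O(L / h)` blocks, each
costing `O(log d)`, while rounding costs `m h`; `h = √(L log d / m)` balances the two. Finally the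
centers are moved into the ellipsoid by the metric projection.

The bound through the effective dimension replaces `log⁺ y` by its tangent line
`y / s + log s - 1`, applied to `y = (σᵢ / (ε σ₁)) ^ p` and with the best admissible `s ≥ e`.
-/

section GreedyCover

variable {X Y : Type*} [MeasurableSpace Y]

open scoped Classical in
theorem exists_mul_card_le_card_filter_mem (ν : Measure Y) [IsProbabilityMeasure ν]
    {s : Finset X} {A : X → Set Y} (hA : ∀ x ∈ s, MeasurableSet (A x)) {p : ℝ}
    (hp : ∀ x ∈ s, p ≤ ν.real (A x)) :
    ∃ y, p * s.card ≤ (s.filter fun x => y ∈ A x).card := by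
  have hint : ∀ x ∈ s, Integrable ((A x).indicator fun _ => (1 : ℝ)) ν := fun x hx =>
    (integrable_const 1).indicator (hA x hx)
  obtain ⟨y, hy⟩ := exists_integral_le (μ := ν) (integrable_finsetSum s hint)
  refine ⟨y, ?_⟩
  calc p * s.card = ∑ _x ∈ s, p := by rw [Finset.sum_const, nsmul_eq_mul, mul_comm]
    _ ≤ ∑ x ∈ s, ν.real (A x) := Finset.sum_le_sum hp
    _ = ∫ z, ∑ x ∈ s, (A x).indicator (fun _ => (1 : ℝ)) z ∂ν := by
      rw [integral_finsetSum s hint]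
      exact Finset.sum_congr rfl fun x hx => (integral_indicator_one (hA x hx)).symm
    _ ≤ ∑ x ∈ s, (A x).indicator (fun _ => (1 : ℝ)) y := hy
    _ = (s.filter fun x => y ∈ A x).card := by
      simp only [Set.indicator_apply, Finset.sum_boole]

theorem exists_cover_all_but_pow_mul_card (ν : Measure Y) [IsProbabilityMeasure ν]
    (s : Finset X) {A : X → Set Y} (hA : ∀ x ∈ s, MeasurableSet (A x)) {p : ℝ} (hp1 : p ≤ 1)
    (hp : ∀ x ∈ s, p ≤ ν.real (A x)) (k : ℕ) :
    ∃ (N : Finset Y) (u : Finset X), u ⊆ s ∧ N.card ≤ k ∧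
      (∀ x ∈ s, x ∉ u → ∃ y ∈ N, y ∈ A x) ∧ (u.card : ℝ) ≤ (1 - p) ^ k * s.card := by
  classical
  induction k with
  | zero => exact ⟨∅, s, subset_rfl, by simp, fun x hx hxs => absurd hx hxs, by simp⟩
  | succ k ih =>
    obtain ⟨N, u, hus, hN, hcov, hcard⟩ := ih
    obtain ⟨y, hy⟩ := exists_mul_card_le_card_filter_mem ν (fun x hx => hA x (hus hx))
      fun x hx => hp x (hus hx)
    refine ⟨insert y N, u.filter fun x => y ∉ A x, (Finset.filter_subset _ _).trans hus,
      (Finset.card_insert_le _ _).trans (by omega), fun x hx hxu => ?_, ?_⟩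
    · by_cases hxA : y ∈ A x
      · exact ⟨y, Finset.mem_insert_self _ _, hxA⟩
      · obtain ⟨z, hzN, hzA⟩ := hcov x hx fun h => hxu (Finset.mem_filter.2 ⟨h, hxA⟩)
        exact ⟨z, Finset.mem_insert_of_mem hzN, hzA⟩
    · have hsplit : ((u.filter fun x => y ∈ A x).card : ℝ) + (u.filter fun x => y ∉ A x).card
          = u.card := by
        exact_mod_cast Finset.card_filter_add_card_filter_not (s := u) fun x => y ∈ A x
      calc ((u.filter fun x => y ∉ A x).card : ℝ) ≤ (1 - p) * u.card := by linarith
        _ ≤ (1 - p) * ((1 - p) ^ k * s.card) :=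
          mul_le_mul_of_nonneg_left hcard (by linarith)
        _ = (1 - p) ^ (k + 1) * s.card := by ring

theorem one_sub_pow_ceil_div_le_exp_neg {p : ℝ} (hp0 : 0 < p) (hp1 : p ≤ 1) (M : ℝ) :
    (1 - p) ^ ⌈M / p⌉₊ ≤ Real.exp (-M) :=
  calc (1 - p) ^ ⌈M / p⌉₊ ≤ Real.exp (-p) ^ ⌈M / p⌉₊ :=
        pow_le_pow_left₀ (sub_nonneg.2 hp1) (Real.one_sub_le_exp_neg p) _
    _ = Real.exp (-(⌈M / p⌉₊ * p)) := by rw [← Real.exp_nat_mul, mul_neg]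
    _ ≤ Real.exp (-M) :=
      Real.exp_le_exp.2 (neg_le_neg ((div_le_iff₀ hp0).1 (Nat.le_ceil _)))

theorem exists_cover_card_le_of_le_measureReal (ν : Measure Y) [IsProbabilityMeasure ν]
    (s : Finset X) {A : X → Set Y} (hA : ∀ x ∈ s, MeasurableSet (A x)) {p M : ℝ} (hp0 : 0 < p)
    (hp1 : p ≤ 1) (hp : ∀ x ∈ s, p ≤ ν.real (A x)) (hM0 : 0 ≤ M)
    (hM : p * s.card ≤ Real.exp M) :
    ∃ N : Finset Y, (∀ x ∈ s, ∃ y ∈ N, y ∈ A x) ∧ (N.card : ℝ) ≤ (M + 1) / p + 1 := by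
  classical
  obtain ⟨N, u, -, hN, hcov, hcard⟩ := exists_cover_all_but_pow_mul_card ν s hA hp1 hp ⌈M / p⌉₊
  have hu : (u.card : ℝ) ≤ 1 / p := by
    rw [le_div_iff₀ hp0]
    calc u.card * p ≤ (1 - p) ^ ⌈M / p⌉₊ * s.card * p := by gcongr
      _ = (1 - p) ^ ⌈M / p⌉₊ * (p * s.card) := by ring
      _ ≤ Real.exp (-M) * Real.exp M := by
        gcongr
        exact one_sub_pow_ceil_div_le_exp_neg hp0 hp1 M
      _ = 1 := by rw [← Real.exp_add, neg_add_cancel, Real.exp_zero]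
  have hne : ∀ x ∈ s, (A x).Nonempty := fun x hx =>
    nonempty_of_measureReal_ne_zero (hp0.trans_le (hp x hx)).ne'
  have : Nonempty Y := nonempty_of_isProbabilityMeasure ν
  choose! f hf using hne
  refine ⟨N ∪ u.image f, fun x hx => ?_, ?_⟩
  · by_cases hxu : x ∈ u
    · exact ⟨f x, Finset.mem_union_right _ (Finset.mem_image_of_mem f hxu), hf x hx⟩
    · obtain ⟨y, hyN, hyA⟩ := hcov x hx hxu
      exact ⟨y, Finset.mem_union_left _ hyN, hyA⟩
  · calc ((N ∪ u.image f).card : ℝ) ≤ N.card + u.card := by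
          exact_mod_cast (Finset.card_union_le _ _).trans (by gcongr; exact Finset.card_image_le)
      _ ≤ (M / p + 1) + 1 / p := by
        gcongr
        exact (Nat.cast_le.2 hN).trans (Nat.ceil_lt_add_one (by positivity)).le
      _ = (M + 1) / p + 1 := by ring

end GreedyCover

section UnitBallNet

variable {E : Type*} [NormedAddCommGroup E] [NormedSpace ℝ E] [FiniteDimensional ℝ E]

open Metric Module
open scoped NNReal ENNReal

theorem card_le_of_isSeparated_of_subset_closedBall {η : ℝ≥0} (hη : 0 < η) {s : Finset E}
    (hs : (s : Set E) ⊆ closedBall 0 1) (hsep : IsSeparated (η : ℝ≥0∞) (s : Set E)) :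
    (s.card : ℝ) ≤ (1 + 2 / (η : ℝ)) ^ finrank ℝ E := by
  borelize E
  have hη' : (0 : ℝ) < η := hη
  let μ : Measure E := Measure.addHaar
  have hdisj : (s : Set E).PairwiseDisjoint fun x => ball x (η / 2) := fun x hx y hy hxy =>
    ball_disjoint_ball <| by
      have hlt : (η : ℝ≥0∞) < edist x y := hsep hx hy hxy
      rw [edist_nndist, ENNReal.coe_lt_coe] at hlt
      have : (η : ℝ) < dist x y := hlt
      linarith
  have hsub : ⋃ x ∈ s, ball x (η / 2) ⊆ ball (0 : E) (1 + η / 2) :=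
    Set.iUnion₂_subset fun x hx => ball_subset_ball' <| by
      linarith [mem_closedBall.1 (hs hx)]
  have hball : ∀ (x : E) (r : ℝ), 0 < r →
      μ.real (ball x r) = r ^ finrank ℝ E * μ.real (ball 0 1) := fun x r hr => by
    rw [measureReal_def, Measure.addHaar_ball_of_pos μ x hr, ENNReal.toReal_mul,
      ENNReal.toReal_ofReal (by positivity), measureReal_def]
  have hpos : 0 < μ.real (ball (0 : E) 1) :=
    ENNReal.toReal_pos (measure_ball_pos μ 0 one_pos).ne' measure_ball_lt_top.ne
  have hvol : s.card * (η / 2 : ℝ) ^ finrank ℝ E ≤ (1 + η / 2) ^ finrank ℝ E := by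
    refine le_of_mul_le_mul_right ?_ hpos
    calc s.card * (η / 2 : ℝ) ^ finrank ℝ E * μ.real (ball (0 : E) 1)
        = ∑ x ∈ s, μ.real (ball x (η / 2)) := by
          simp only [hball _ _ (half_pos hη'), Finset.sum_const, nsmul_eq_mul, mul_assoc]
      _ = μ.real (⋃ x ∈ s, ball x (η / 2)) :=
          (measureReal_biUnion_finset hdisj fun _ _ => measurableSet_ball).symm
      _ ≤ μ.real (ball (0 : E) (1 + η / 2)) := measureReal_mono hsub measure_ball_lt_top.ne
      _ = (1 + η / 2) ^ finrank ℝ E * μ.real (ball (0 : E) 1) := hball 0 _ (by positivity)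
  calc (s.card : ℝ) ≤ (1 + η / 2) ^ finrank ℝ E / (η / 2) ^ finrank ℝ E :=
        (le_div_iff₀ (by positivity)).2 hvol
    _ = (1 + 2 / (η : ℝ)) ^ finrank ℝ E := by
      rw [← div_pow, add_div, div_self (by positivity), one_div_div, add_comm]

theorem packingNumber_closedBall_ne_top {η : ℝ≥0} (hη : 0 < η) (x : E) (r : ℝ) :
    packingNumber η (closedBall x r) ≠ ⊤ := by
  have : ProperSpace E := FiniteDimensional.proper ℝ E
  obtain ⟨C, -, hCfin, hC⟩ :=
    exists_finite_isCover_of_isCompact (half_pos hη).ne' (isCompact_closedBall x r)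
  refine ne_top_of_le_ne_top (Set.encard_ne_top_iff.2 hCfin) ?_
  calc packingNumber η (closedBall x r) = packingNumber (2 * (η / 2)) (closedBall x r) := by
        rw [mul_div_cancel₀ _ two_ne_zero]
    _ ≤ externalCoveringNumber (η / 2) (closedBall x r) :=
      packingNumber_two_mul_le_externalCoveringNumber _ _
    _ ≤ C.encard := hC.externalCoveringNumber_le_encard

theorem exists_finset_subset_closedBall_dist_le_card_le {η : ℝ} (hη : 0 < η) :
    ∃ s : Finset E, (s : Set E) ⊆ closedBall 0 1 ∧
      (∀ x ∈ closedBall (0 : E) 1, ∃ y ∈ s, dist x y ≤ η) ∧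
      (s.card : ℝ) ≤ (1 + 2 / η) ^ finrank ℝ E := by
  lift η to ℝ≥0 using hη.le
  have hpack : packingNumber η (closedBall (0 : E) 1) ≠ ⊤ :=
    packingNumber_closedBall_ne_top hη 0 1
  have hfin : (maximalSeparatedSet η (closedBall (0 : E) 1)).Finite :=
    Set.encard_ne_top_iff.1 ((encard_maximalSeparatedSet hpack).trans_ne hpack)
  have hcoe : (hfin.toFinset : Set E) = maximalSeparatedSet η (closedBall 0 1) := hfin.coe_toFinset
  have hsub : (hfin.toFinset : Set E) ⊆ closedBall 0 1 :=
    hcoe.trans_subset maximalSeparatedSet_subset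
  refine ⟨hfin.toFinset, hsub, fun x hx => ?_, ?_⟩
  · obtain ⟨y, hy, hxy⟩ := isCover_maximalSeparatedSet hpack hx
    have hxy' : edist x y ≤ η := hxy
    rw [edist_nndist, ENNReal.coe_le_coe] at hxy'
    exact ⟨y, hfin.mem_toFinset.2 hy, hxy'⟩
  · refine card_le_of_isSeparated_of_subset_closedBall (by exact_mod_cast hη) hsub ?_
    rw [hcoe]
    exact isSeparated_maximalSeparatedSet

end UnitBallNet

section BallLens

variable {E : Type*} [NormedAddCommGroup E] [InnerProductSpace ℝ E]

open Metric Module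
open scoped Pointwise

/-- The part of the centered ball of radius `s` lying in the slab `a ≤ ⟪x, w⟫ ≤ b`. The vector `x`
is not normalized, so the width of the slab is `(b - a) / ‖x‖`. -/
def ballSlab (x : E) (s a b : ℝ) : Set E :=
  {w | ‖w‖ ≤ s ∧ a ≤ inner ℝ x w ∧ inner ℝ x w ≤ b}

theorem ballSlab_subset_closedBall (x : E) (s a b : ℝ) : ballSlab x s a b ⊆ closedBall 0 s :=
  fun _ hw => mem_closedBall_zero_iff.2 hw.1

theorem sub_smul_mem_ballSlab {x w : E} (hx : x ≠ 0) {s a h : ℝ} (ha : 0 ≤ a)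
    (hw : w ∈ ballSlab x s a (a + h)) : w - (a / ‖x‖ ^ 2) • x ∈ ballSlab x s 0 h := by
  obtain ⟨hws, haw, hwb⟩ := hw
  have hx2 : 0 < ‖x‖ ^ 2 := by positivity
  have hinner : inner ℝ x (w - (a / ‖x‖ ^ 2) • x) = inner ℝ x w - a := by
    rw [inner_sub_right, inner_smul_right, real_inner_self_eq_norm_sq, div_mul_cancel₀ _ hx2.ne']
  refine ⟨le_trans ?_ hws, by linarith, by linarith⟩
  refine (sq_le_sq₀ (norm_nonneg _) (norm_nonneg _)).1 ?_
  calc ‖w - (a / ‖x‖ ^ 2) • x‖ ^ 2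
      = ‖w‖ ^ 2 - a / ‖x‖ ^ 2 * (2 * inner ℝ x w - a) := by
        rw [norm_sub_sq_real, inner_smul_right, norm_smul, mul_pow, Real.norm_eq_abs, sq_abs,
          real_inner_comm]
        field_simp
        ring
    _ ≤ ‖w‖ ^ 2 := sub_le_self _ (mul_nonneg (by positivity) (by linarith))

theorem sq_smul_sub_mul_smul_mem_lens {R δ : ℝ} (hδ : 0 < δ) (hδR : δ ≤ R)
    (hsum : R ^ 2 + δ ^ 2 = 1) {x w : E} (hx : ‖x‖ ≤ 1) (hxw : 0 ≤ inner ℝ x w)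
    (hw : 2 * inner ℝ x w + ‖w‖ ^ 2 ≤ 1) :
    R ^ 2 • x - (R * δ) • w ∈ closedBall 0 R ∩ closedBall x δ := by
  have hR : 0 < R := hδ.trans_le hδR
  have hx2 : ‖x‖ ^ 2 ≤ 1 := pow_le_one₀ (norm_nonneg x) hx
  have hnorm : ∀ α β : ℝ, ‖α • x - β • w‖ ^ 2 =
      α ^ 2 * ‖x‖ ^ 2 - 2 * α * β * inner ℝ x w + β ^ 2 * ‖w‖ ^ 2 := fun α β => by
    rw [norm_sub_sq_real, norm_smul, norm_smul, inner_smul_left, inner_smul_right, mul_pow,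
      mul_pow, Real.norm_eq_abs, Real.norm_eq_abs, sq_abs, sq_abs, conj_trivial]
    ring
  have hcenter : R ^ 2 • x - (R * δ) • w - x = (-δ ^ 2) • x - (R * δ) • w := by
    rw [show -δ ^ 2 = R ^ 2 - 1 by linarith, sub_smul, one_smul]
    abel
  constructor
  · rw [mem_closedBall_zero_iff, ← sq_le_sq₀ (norm_nonneg _) hR.le, hnorm]
    calc (R ^ 2) ^ 2 * ‖x‖ ^ 2 - 2 * R ^ 2 * (R * δ) * inner ℝ x w + (R * δ) ^ 2 * ‖w‖ ^ 2
        = R ^ 2 * (R ^ 2 * ‖x‖ ^ 2 + δ ^ 2 * ‖w‖ ^ 2 - 2 * (R * δ) * inner ℝ x w) := by ring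
      _ ≤ R ^ 2 * (R ^ 2 * 1 + δ ^ 2 * 1 - 0) := by
        gcongr
        · linarith
        · positivity
      _ = R ^ 2 := by rw [mul_one, mul_one, hsum, sub_zero, mul_one]
  · rw [mem_closedBall, dist_eq_norm, hcenter, ← sq_le_sq₀ (norm_nonneg _) hδ.le, hnorm]
    calc (-δ ^ 2) ^ 2 * ‖x‖ ^ 2 - 2 * -δ ^ 2 * (R * δ) * inner ℝ x w + (R * δ) ^ 2 * ‖w‖ ^ 2
        = δ ^ 2 * (δ ^ 2 * ‖x‖ ^ 2 + (R * δ * (2 * inner ℝ x w) + R * R * ‖w‖ ^ 2)) := by ring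
      _ ≤ δ ^ 2 * (δ ^ 2 * 1 + (R * R * (2 * inner ℝ x w) + R * R * ‖w‖ ^ 2)) := by gcongr
      _ = δ ^ 2 * (δ ^ 2 + R ^ 2 * (2 * inner ℝ x w + ‖w‖ ^ 2)) := by ring
      _ ≤ δ ^ 2 * (δ ^ 2 + R ^ 2 * 1) := by gcongr
      _ = δ ^ 2 := by rw [mul_one, add_comm, hsum, mul_one]

-- The reflection `y ↦ x - y` exchanges the two balls, hence the roles of `R` and `δ`.
theorem exists_sq_smul_add_smul_mem_lens {R δ : ℝ} (hR : 0 < R) (hδ : 0 < δ)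
    (hsum : R ^ 2 + δ ^ 2 = 1) {x : E} (hx : ‖x‖ ≤ 1) :
    ∃ t : ℝ, |t| = R * δ ∧ ∀ w : E, 0 ≤ inner ℝ x w → 2 * inner ℝ x w + ‖w‖ ^ 2 ≤ 1 →
      R ^ 2 • x + t • w ∈ closedBall 0 R ∩ closedBall x δ := by
  rcases le_total δ R with hle | hle
  · refine ⟨-(R * δ), by rw [abs_neg, abs_of_pos (by positivity)], fun w hxw hw => ?_⟩
    rw [neg_smul, ← sub_eq_add_neg]
    exact sq_smul_sub_mul_smul_mem_lens hδ hle hsum hx hxw hw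
  · refine ⟨R * δ, abs_of_pos (by positivity), fun w hxw hw => ?_⟩
    obtain ⟨h0, hx⟩ :=
      sq_smul_sub_mul_smul_mem_lens hR hle ((add_comm _ _).trans hsum) hx hxw hw
    have hrefl : R ^ 2 • x + (R * δ) • w = x - (δ ^ 2 • x - (δ * R) • w) := by
      rw [show R ^ 2 = 1 - δ ^ 2 by linarith, sub_smul, one_smul, mul_comm R δ]
      abel
    rw [hrefl, Set.mem_inter_iff, mem_closedBall_zero_iff, mem_closedBall, dist_eq_norm,
      sub_sub_cancel_left, norm_neg]
    exact ⟨by rwa [← dist_eq_norm, dist_comm], mem_closedBall_zero_iff.1 h0⟩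

variable [FiniteDimensional ℝ E] [MeasurableSpace E] (μ : Measure E) [μ.IsAddHaarMeasure]

theorem measure_ballSlab_ne_top (x : E) (s a b : ℝ) : μ (ballSlab x s a b) ≠ ⊤ :=
  measure_ne_top_of_subset (ballSlab_subset_closedBall x s a b) measure_closedBall_lt_top.ne

variable [BorelSpace E]

theorem measureReal_ballSlab_add_le (x : E) (s : ℝ) {a h : ℝ} (ha : 0 ≤ a) :
    μ.real (ballSlab x s a (a + h)) ≤ μ.real (ballSlab x s 0 h) := by
  rcases eq_or_ne x 0 with rfl | hx
  · refine measureReal_mono (fun w hw => ?_) (measure_ballSlab_ne_top μ 0 s 0 h)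
    simp only [ballSlab, inner_zero_left, Set.mem_ofPred_eq] at hw ⊢
    exact ⟨hw.1, le_rfl, by linarith⟩
  · have hsub : ballSlab x s a (a + h) ⊆ (· - (a / ‖x‖ ^ 2) • x) ⁻¹' ballSlab x s 0 h :=
      fun w hw => sub_smul_mem_ballSlab hx ha hw
    have hpre : μ ((· - (a / ‖x‖ ^ 2) • x) ⁻¹' ballSlab x s 0 h) = μ (ballSlab x s 0 h) := by
      simp only [sub_eq_add_neg, measure_preimage_add_right]
    calc μ.real (ballSlab x s a (a + h))
        ≤ μ.real ((· - (a / ‖x‖ ^ 2) • x) ⁻¹' ballSlab x s 0 h) :=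
          measureReal_mono hsub (hpre.trans_ne (measure_ballSlab_ne_top μ x s 0 h))
      _ = μ.real (ballSlab x s 0 h) := congrArg ENNReal.toReal hpre

theorem measureReal_ballSlab_nat_mul_le (x : E) (s : ℝ) {h : ℝ} (hh : 0 ≤ h) {k : ℕ}
    (hk : 0 < k) : μ.real (ballSlab x s 0 (k * h)) ≤ k * μ.real (ballSlab x s 0 h) := by
  induction k, hk using Nat.le_induction with
  | base => simp
  | succ k _ ih =>
    have hsub : ballSlab x s 0 ((k + 1 : ℕ) * h) ⊆
        ballSlab x s 0 (k * h) ∪ ballSlab x s (k * h) (k * h + h) := by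
      rintro w ⟨hws, hw0, hwk⟩
      push_cast at hwk
      rcases le_total (inner ℝ x w) (k * h) with hle | hle
      exacts [Or.inl ⟨hws, hw0, hle⟩, Or.inr ⟨hws, hle, by linarith⟩]
    calc μ.real (ballSlab x s 0 ((k + 1 : ℕ) * h))
        ≤ μ.real (ballSlab x s 0 (k * h) ∪ ballSlab x s (k * h) (k * h + h)) :=
          measureReal_mono hsub (measure_union_ne_top (measure_ballSlab_ne_top μ _ _ _ _)
            (measure_ballSlab_ne_top μ _ _ _ _))
      _ ≤ μ.real (ballSlab x s 0 (k * h)) + μ.real (ballSlab x s (k * h) (k * h + h)) :=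
          measureReal_union_le _ _
      _ ≤ k * μ.real (ballSlab x s 0 h) + μ.real (ballSlab x s 0 h) :=
          add_le_add ih (measureReal_ballSlab_add_le μ x s (by positivity))
      _ = (k + 1 : ℕ) * μ.real (ballSlab x s 0 h) := by push_cast; ring

theorem measureReal_closedBall_le_mul_ballSlab (x : E) {s h : ℝ} {k : ℕ} (hk : 0 < k)
    (hh : 0 ≤ h) (hxs : ‖x‖ * s ≤ k * h) :
    μ.real (closedBall 0 s) ≤ 2 * k * μ.real (ballSlab x s 0 h) := by
  have hsub : closedBall 0 s ⊆ ballSlab x s 0 (k * h) ∪ -ballSlab x s 0 (k * h) := by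
    intro w hw
    have hws : ‖w‖ ≤ s := mem_closedBall_zero_iff.1 hw
    obtain ⟨hlo, hhi⟩ := abs_le.1 <| (abs_real_inner_le_norm x w).trans <|
      (mul_le_mul_of_nonneg_left hws (norm_nonneg x)).trans hxs
    rcases le_total 0 (inner ℝ x w) with hle | hle
    · exact Or.inl ⟨hws, hle, hhi⟩
    · refine Or.inr ⟨by rwa [norm_neg], ?_, ?_⟩ <;> rw [inner_neg_right] <;> linarith
  have hneg : μ (-ballSlab x s 0 (k * h)) = μ (ballSlab x s 0 (k * h)) := Measure.measure_neg μ _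
  have hfin := measure_ballSlab_ne_top μ x s 0 (k * h)
  calc μ.real (closedBall 0 s)
      ≤ μ.real (ballSlab x s 0 (k * h) ∪ -ballSlab x s 0 (k * h)) :=
        measureReal_mono hsub (measure_union_ne_top hfin (hneg.trans_ne hfin))
    _ ≤ μ.real (ballSlab x s 0 (k * h)) + μ.real (-ballSlab x s 0 (k * h)) :=
        measureReal_union_le _ _
    _ = 2 * μ.real (ballSlab x s 0 (k * h)) := by
        rw [measureReal_def μ (-_), hneg, ← measureReal_def, two_mul]
    _ ≤ 2 * (k * μ.real (ballSlab x s 0 h)) :=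
        mul_le_mul_of_nonneg_left (measureReal_ballSlab_nat_mul_le μ x s hh hk) two_pos.le
    _ = 2 * k * μ.real (ballSlab x s 0 h) := by ring

theorem pow_mul_measureReal_ballSlab_le_lens {R δ : ℝ} (hR : 0 < R) (hδ : 0 < δ)
    (hsum : R ^ 2 + δ ^ 2 = 1) {x : E} (hx : ‖x‖ ≤ 1) {s h : ℝ} (hsh : 2 * h + s ^ 2 ≤ 1) :
    (R * δ) ^ finrank ℝ E * μ.real (ballSlab x s 0 h) ≤
      μ.real (closedBall 0 R ∩ closedBall x δ) := by
  obtain ⟨t, ht, hmem⟩ := exists_sq_smul_add_smul_mem_lens hR hδ hsum hx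
  have hsub : t • ballSlab x s 0 h ⊆
      (R ^ 2 • x + ·) ⁻¹' (closedBall 0 R ∩ closedBall x δ) := by
    rintro _ ⟨w, ⟨hws, hxw, hwh⟩, rfl⟩
    exact hmem w hxw (by linarith [pow_le_pow_left₀ (norm_nonneg w) hws 2])
  have hle : μ (t • ballSlab x s 0 h) ≤ μ (closedBall 0 R ∩ closedBall x δ) :=
    (measure_mono hsub).trans_eq (measure_preimage_add μ _ _)
  have hfin : μ (closedBall 0 R ∩ closedBall x δ) ≠ ⊤ :=
    measure_ne_top_of_subset Set.inter_subset_left measure_closedBall_lt_top.ne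
  have := ENNReal.toReal_mono hfin hle
  rwa [Measure.addHaar_smul, abs_pow, ht, ENNReal.toReal_mul,
    ENNReal.toReal_ofReal (by positivity)] at this

theorem half_le_one_sub_inv_two_mul_succ_pow (n : ℕ) :
    1 / 2 ≤ (1 - 1 / (2 * ((n : ℝ) + 1))) ^ n := by
  have hn : 1 / (2 * ((n : ℝ) + 1)) ≤ 2 := by
    rw [div_le_iff₀ (by positivity)]
    linarith [n.cast_nonneg (α := ℝ)]
  calc (1 : ℝ) / 2 ≤ 1 + n * -(1 / (2 * ((n : ℝ) + 1))) := by
        field_simp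
        linarith
    _ ≤ (1 - 1 / (2 * ((n : ℝ) + 1))) ^ n :=
        one_add_mul_le_pow (neg_le_neg hn) n

theorem measureReal_closedBall_one_le_mul_ballSlab {x : E} (hx : ‖x‖ ≤ 1) {κ : ℝ}
    (hκ : κ = 1 / (2 * ((finrank ℝ E : ℝ) + 1))) :
    μ.real (closedBall 0 1) ≤
      16 * (finrank ℝ E + 1) * μ.real (ballSlab x (1 - κ) 0 (κ / 2)) := by
  set n := finrank ℝ E
  have hκ1 : κ * (2 * ((n : ℝ) + 1)) = 1 := by rw [hκ]; exact one_div_mul_cancel (by positivity)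
  have hκ0 : 0 < κ := by rw [hκ]; positivity
  have hκle : κ ≤ 1 := by nlinarith [n.cast_nonneg (α := ℝ)]
  have hslab := measureReal_closedBall_le_mul_ballSlab μ x (s := 1 - κ) (h := κ / 2)
    (k := 4 * (n + 1)) (by positivity) (by positivity) <| by
      push_cast
      nlinarith [mul_le_mul hx (sub_le_self 1 hκ0.le) (sub_nonneg.2 hκle) zero_le_one]
  have hhalf : 1 / 2 ≤ (1 - κ) ^ n := hκ ▸ half_le_one_sub_inv_two_mul_succ_pow n
  have hball : μ.real (closedBall 0 (1 - κ)) = (1 - κ) ^ n * μ.real (closedBall (0 : E) 1) :=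
    Measure.addHaar_real_closedBall' μ 0 (sub_nonneg.2 hκle)
  push_cast at hslab
  nlinarith [mul_le_mul_of_nonneg_right hhalf (measureReal_nonneg (μ := μ) (s := closedBall 0 1))]

theorem pow_mul_measureReal_closedBall_le_lens {R δ : ℝ} (hR : 0 < R) (hδ : 0 < δ)
    (hsum : R ^ 2 + δ ^ 2 = 1) {x : E} (hx : ‖x‖ ≤ 1) :
    δ ^ finrank ℝ E * μ.real (closedBall (0 : E) R) ≤
      16 * (finrank ℝ E + 1) * μ.real (closedBall 0 R ∩ closedBall x δ) := by
  obtain ⟨κ, hκ⟩ : ∃ κ : ℝ, κ = 1 / (2 * ((finrank ℝ E : ℝ) + 1)) := ⟨_, rfl⟩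
  have hκ0 : 0 < κ := by rw [hκ]; positivity
  have hκ1 : κ ≤ 1 := by
    rw [hκ, div_le_one (by positivity)]
    linarith [(finrank ℝ E).cast_nonneg (α := ℝ)]
  calc δ ^ finrank ℝ E * μ.real (closedBall (0 : E) R)
      = (R * δ) ^ finrank ℝ E * μ.real (closedBall (0 : E) 1) := by
        rw [Measure.addHaar_real_closedBall' μ 0 hR.le, mul_pow]
        ring
    _ ≤ (R * δ) ^ finrank ℝ E *
          (16 * (finrank ℝ E + 1) * μ.real (ballSlab x (1 - κ) 0 (κ / 2))) := by
        gcongr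
        exact measureReal_closedBall_one_le_mul_ballSlab μ hx hκ
    _ = 16 * (finrank ℝ E + 1) *
          ((R * δ) ^ finrank ℝ E * μ.real (ballSlab x (1 - κ) 0 (κ / 2))) := by ring
    _ ≤ 16 * (finrank ℝ E + 1) * μ.real (closedBall 0 R ∩ closedBall x δ) := by
        gcongr
        exact pow_mul_measureReal_ballSlab_le_lens μ hR hδ hsum hx (by nlinarith)

end BallLens

section UnitBallCover

variable {E : Type*} [NormedAddCommGroup E] [InnerProductSpace ℝ E] [FiniteDimensional ℝ E]

open Metric Module ProbabilityTheory

theorem exists_isProbabilityMeasure_pow_le_measureReal_closedBall [MeasurableSpace E]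
    [BorelSpace E] {δ : ℝ} (hδ : 0 < δ) (hδ1 : δ < 1) :
    ∃ ν : Measure E, IsProbabilityMeasure ν ∧ ∀ x : E, ‖x‖ ≤ 1 →
      δ ^ finrank ℝ E / (16 * (finrank ℝ E + 1)) ≤ ν.real (closedBall x δ) := by
  have hR2 : 0 < 1 - δ ^ 2 := by nlinarith
  set R : ℝ := √(1 - δ ^ 2)
  have hR : 0 < R := Real.sqrt_pos.2 hR2
  have hsum : R ^ 2 + δ ^ 2 = 1 := by rw [Real.sq_sqrt hR2.le, sub_add_cancel]
  let μ : Measure E := Measure.addHaar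
  have hfin : μ (closedBall 0 R) ≠ ⊤ := measure_closedBall_lt_top.ne
  have hpos : μ (closedBall 0 R) ≠ 0 := (measure_closedBall_pos μ 0 hR).ne'
  refine ⟨cond μ (closedBall 0 R), cond_isProbabilityMeasure_of_finite hpos hfin, fun x hx => ?_⟩
  have hvol : 0 < μ.real (closedBall 0 R) := ENNReal.toReal_pos hpos hfin
  have hcond : (cond μ (closedBall 0 R)).real (closedBall x δ) =
      μ.real (closedBall 0 R ∩ closedBall x δ) / μ.real (closedBall 0 R) := by
    rw [measureReal_def, cond_apply measurableSet_closedBall, ENNReal.toReal_mul,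
      ENNReal.toReal_inv, ← div_eq_inv_mul]
    rfl
  rw [hcond, div_le_div_iff₀ (by positivity) hvol, mul_comm (μ.real (_ ∩ _))]
  exact pow_mul_measureReal_closedBall_le_lens μ hR hδ hsum hx

theorem exists_card_le_dist_le_mul_of_subset_closedBall {δ κ : ℝ} (hδ : 0 < δ) (hδ1 : δ < 1)
    (hκ : κ = 1 / (2 * ((finrank ℝ E : ℝ) + 1))) {X : Finset E}
    (hX : (X : Set E) ⊆ closedBall 0 1) {M : ℝ} (hM0 : 0 ≤ M)
    (hM : δ ^ finrank ℝ E * X.card ≤ Real.exp M) :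
    ∃ N : Finset E, (∀ x ∈ X, ∃ y ∈ N, dist x y ≤ (1 - κ) * δ) ∧
      (N.card : ℝ) ≤ (M + 1) * (32 * (finrank ℝ E + 1)) * (1 / δ) ^ finrank ℝ E + 1 := by
  borelize E
  set n := finrank ℝ E
  have hκ0 : 0 < κ := by rw [hκ]; positivity
  have hκ1 : κ < 1 := by
    rw [hκ, div_lt_one (by positivity)]
    linarith [n.cast_nonneg (α := ℝ)]
  have hδ' : (1 - κ) * δ < 1 := by nlinarith
  obtain ⟨ν, _, hν⟩ := exists_isProbabilityMeasure_pow_le_measureReal_closedBall (E := E)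
    (mul_pos (sub_pos.2 hκ1) hδ) hδ'
  set p : ℝ := δ ^ n / (32 * (n + 1)) with hp
  have hp0 : 0 < p := by positivity
  have hpδ : p ≤ δ ^ n := div_le_self (by positivity) (by linarith [n.cast_nonneg (α := ℝ)])
  have hpν : ∀ x ∈ X, p ≤ ν.real (closedBall x ((1 - κ) * δ)) := fun x hx =>
    calc p = 1 / 2 * δ ^ n / (16 * (n + 1)) := by rw [hp]; field_simp; norm_num
      _ ≤ (1 - κ) ^ n * δ ^ n / (16 * (n + 1)) := by
        gcongr
        exact hκ ▸ half_le_one_sub_inv_two_mul_succ_pow n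
      _ ≤ ν.real (closedBall x ((1 - κ) * δ)) := by
        rw [← mul_pow]
        exact hν x (mem_closedBall_zero_iff.1 (hX hx))
  obtain ⟨N, hN, hcard⟩ := exists_cover_card_le_of_le_measureReal ν X
    (fun _ _ => measurableSet_closedBall) hp0 (hpδ.trans (pow_le_one₀ hδ.le hδ1.le)) hpν hM0
    ((mul_le_mul_of_nonneg_right hpδ X.card.cast_nonneg).trans hM)
  refine ⟨N, fun x hx => ?_, hcard.trans_eq ?_⟩
  · obtain ⟨y, hy, hyx⟩ := hN x hx
    exact ⟨y, hy, mem_closedBall'.1 hyx⟩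
  · rw [hp, one_div, inv_pow, div_div_eq_mul_div, div_eq_mul_inv]

theorem exists_cover_unitBall_card_le {δ : ℝ} (hδ : 0 < δ) (hδ1 : δ < 1) :
    ∃ N : Finset E, (∀ x : E, ‖x‖ ≤ 1 → ∃ y ∈ N, dist x y ≤ δ) ∧
      (N.card : ℝ) ≤ 129 * (finrank ℝ E + 1) ^ 3 * (1 / δ) ^ finrank ℝ E := by
  set n := finrank ℝ E
  have hn0 : (0 : ℝ) ≤ n := n.cast_nonneg
  obtain ⟨κ, hκ⟩ : ∃ κ : ℝ, κ = 1 / (2 * ((n : ℝ) + 1)) := ⟨_, rfl⟩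
  obtain ⟨X, hXball, hXnet, hXcard⟩ :=
    exists_finset_subset_closedBall_dist_le_card_le (E := E) (η := κ * δ)
      (mul_pos (by rw [hκ]; positivity) hδ)
  have hbase : 1 + 2 / (κ * δ) ≤ (4 * n + 5) / δ := by
    rw [hκ, le_div_iff₀ hδ]
    field_simp
    nlinarith
  have hM : δ ^ n * X.card ≤ Real.exp (n * (4 * n + 4)) :=
    calc δ ^ n * X.card ≤ δ ^ n * ((4 * n + 5) / δ) ^ n := by
          gcongr
          exact hXcard.trans (pow_le_pow_left₀ (by rw [hκ]; positivity) hbase n)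
      _ = (4 * n + 5) ^ n := by rw [← mul_pow, mul_div_cancel₀ _ hδ.ne']
      _ ≤ Real.exp (4 * n + 4) ^ n := by
        gcongr
        linarith [Real.add_one_le_exp (4 * (n : ℝ) + 4)]
      _ = Real.exp (n * (4 * n + 4)) := (Real.exp_nat_mul _ _).symm
  obtain ⟨N, hN, hcard⟩ :=
    exists_card_le_dist_le_mul_of_subset_closedBall hδ hδ1 hκ hXball (by positivity) hM
  refine ⟨N, fun x hx => ?_, ?_⟩
  · obtain ⟨y, hy, hxy⟩ := hXnet x (mem_closedBall_zero_iff.2 hx)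
    obtain ⟨z, hz, hyz⟩ := hN y hy
    exact ⟨z, hz, by linarith [dist_triangle x y z]⟩
  · have hpow : 1 ≤ (1 / δ) ^ n := one_le_pow₀ (by rw [le_div_iff₀ hδ]; linarith)
    calc (N.card : ℝ) ≤ (n * (4 * n + 4) + 1) * (32 * (n + 1)) * (1 / δ) ^ n + 1 := hcard
      _ ≤ (n * (4 * n + 4) + 1) * (32 * (n + 1)) * (1 / δ) ^ n + 1 * (1 / δ) ^ n := by linarith
      _ = ((n * (4 * n + 4) + 1) * (32 * (n + 1)) + 1) * (1 / δ) ^ n := by ring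
      _ ≤ 129 * (n + 1) ^ 3 * (1 / δ) ^ n := by
        gcongr
        nlinarith [mul_nonneg hn0 hn0, mul_nonneg (mul_nonneg hn0 hn0) hn0]

end UnitBallCover

section DilationCover

variable {E : Type*} [NormedAddCommGroup E]

open Module

/-- `G` covers every ball of radius `b ρ`, `0 ≤ ρ ≤ 1`, with squared error `(ρ² + t) e²`: up to the
defect `t`, the accuracy `ρ e` is proportional to the radius of the ball. Covers of this kind are
the factors of the covers of an ellipsoid by products. -/
def IsDilationCover (G : Finset E) (b e t : ℝ) : Prop :=
  ∀ ρ ∈ Set.Icc (0 : ℝ) 1, ∀ z : E, ‖z‖ ≤ b * ρ → ∃ y ∈ G, ‖z - y‖ ^ 2 ≤ (ρ ^ 2 + t) * e ^ 2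

variable [InnerProductSpace ℝ E]

theorem exists_dist_smul_le_mul_of_norm_le {N : Finset E} {δ : ℝ}
    (hN : ∀ x : E, ‖x‖ ≤ 1 → ∃ y ∈ N, dist x y ≤ δ) {R : ℝ} {z : E} (hz : ‖z‖ ≤ R) :
    ∃ y ∈ N, dist z (R • y) ≤ R * δ := by
  have hR0 : 0 ≤ R := (norm_nonneg z).trans hz
  obtain ⟨y, hy, hzy⟩ := hN (R⁻¹ • z) <| by
    rw [norm_smul, norm_inv, Real.norm_of_nonneg hR0, inv_mul_eq_div]
    exact div_le_one_of_le₀ hz hR0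
  refine ⟨y, hy, ?_⟩
  rcases hR0.eq_or_lt with rfl | hR
  · simp [norm_le_zero_iff.1 hz]
  · calc dist z (R • y) = dist (R • R⁻¹ • z) (R • y) := by rw [smul_inv_smul₀ hR.ne']
      _ = R * dist (R⁻¹ • z) y := by rw [dist_smul₀, Real.norm_of_nonneg hR0]
      _ ≤ R * δ := mul_le_mul_of_nonneg_left hzy hR0

theorem exists_sqrt_div_mem_Icc {D : ℕ} (hD : 0 < D) {ρ : ℝ} (hρ : ρ ∈ Set.Icc (0 : ℝ) 1) :
    ∃ k ≤ D, ρ ≤ √((k : ℝ) / D) ∧ (k : ℝ) / D ≤ ρ ^ 2 + 1 / D := by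
  have hD' : (0 : ℝ) < D := by exact_mod_cast hD
  refine ⟨⌈D * ρ ^ 2⌉₊, Nat.ceil_le.2 ?_, Real.le_sqrt_of_sq_le ?_, ?_⟩
  · exact mul_le_of_le_one_right hD'.le (pow_le_one₀ hρ.1 hρ.2)
  · exact (le_div_iff₀' hD').2 (Nat.le_ceil _)
  · rw [div_le_iff₀ hD', add_mul, one_div_mul_cancel hD'.ne', mul_comm]
    exact (Nat.ceil_lt_add_one (by positivity)).le

theorem exists_isDilationCover_card_le [FiniteDimensional ℝ E] {e b : ℝ} (he : 0 < e)
    (heb : e < b) {D : ℕ} (hD : 0 < D) :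
    ∃ G : Finset E, IsDilationCover G b e (1 / D) ∧
      (G.card : ℝ) ≤ (D + 1) * (129 * (finrank ℝ E + 1) ^ 3) * (b / e) ^ finrank ℝ E := by
  classical
  have hb : 0 < b := he.trans heb
  obtain ⟨N, hN, hcard⟩ := exists_cover_unitBall_card_le (E := E) (div_pos he hb)
    ((div_lt_one hb).2 heb)
  rw [one_div_div] at hcard
  refine ⟨(Finset.range (D + 1) ×ˢ N).image fun q => (b * √((q.1 : ℝ) / D)) • q.2,
    fun ρ hρ z hz => ?_, ?_⟩
  · obtain ⟨k, hkD, hρk, hk⟩ := exists_sqrt_div_mem_Icc hD hρ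
    obtain ⟨y, hy, hzy⟩ := exists_dist_smul_le_mul_of_norm_le hN
      (hz.trans (mul_le_mul_of_nonneg_left hρk hb.le))
    refine ⟨_, Finset.mem_image_of_mem _
      (Finset.mk_mem_product (Finset.mem_range_succ_iff.2 hkD) hy), ?_⟩
    calc ‖z - (b * √((k : ℝ) / D)) • y‖ ^ 2 ≤ (b * √((k : ℝ) / D) * (e / b)) ^ 2 := by
          rw [← dist_eq_norm]
          gcongr
      _ = √((k : ℝ) / D) ^ 2 * e ^ 2 := by field_simp
      _ = k / D * e ^ 2 := by rw [Real.sq_sqrt (by positivity)]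
      _ ≤ (ρ ^ 2 + 1 / D) * e ^ 2 := by gcongr
  · calc (((Finset.range (D + 1) ×ˢ N).image fun q => (b * √((q.1 : ℝ) / D)) • q.2).card : ℝ)
        ≤ (D + 1) * N.card := by
          refine (Nat.cast_le.2 Finset.card_image_le).trans_eq ?_
          rw [Finset.card_product, Finset.card_range]
          push_cast
          rfl
      _ ≤ (D + 1) * (129 * (finrank ℝ E + 1) ^ 3 * (b / e) ^ finrank ℝ E) := by gcongr
      _ = (D + 1) * (129 * (finrank ℝ E + 1) ^ 3) * (b / e) ^ finrank ℝ E := by ring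

theorem sq_add_one_mul_succ_pow_three_le_pow {d : ℝ} (hd : 2 ≤ d) :
    (d ^ 2 + 1) * (129 * (d + 1) ^ 3) ≤ d ^ 15 :=
  calc (d ^ 2 + 1) * (129 * (d + 1) ^ 3) ≤ (5 / 4 * d ^ 2) * (129 * (3 / 2 * d) ^ 3) := by
        gcongr
        · nlinarith
        · linarith
    _ ≤ 2 ^ 10 * d ^ 5 := by
        ring_nf
        gcongr
        norm_num
    _ ≤ d ^ 10 * d ^ 5 := by gcongr
    _ = d ^ 15 := by ring

theorem exists_isDilationCover_card_le_pow [FiniteDimensional ℝ E] {e b : ℝ} (he : 0 < e)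
    (heb : e < b) {d : ℕ} (hd : 2 ≤ d) (hE : finrank ℝ E ≤ d) :
    ∃ G : Finset E, IsDilationCover G b e (1 / d ^ 2) ∧
      (G.card : ℝ) ≤ d ^ 15 * (b / e) ^ finrank ℝ E := by
  obtain ⟨G, hG, hcard⟩ := exists_isDilationCover_card_le (E := E) he heb (D := d ^ 2)
    (by positivity)
  have hbe : 0 ≤ b / e := div_nonneg (he.trans heb).le he.le
  have hE' : (finrank ℝ E : ℝ) ≤ d := by exact_mod_cast hE
  push_cast at hG hcard
  refine ⟨G, hG, hcard.trans (mul_le_mul_of_nonneg_right ?_ (pow_nonneg hbe _))⟩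
  exact le_trans (by gcongr) (sq_add_one_mul_succ_pow_three_le_pow (by exact_mod_cast hd))

end DilationCover

section Blocks

variable {ι κ : Type*} (blk : ι → κ)

/-- The subvector of `x` on the block `blk ⁻¹' {j}`. -/
def blockProj (x : EuclideanSpace ℝ ι) (j : κ) : EuclideanSpace ℝ {i // blk i = j} :=
  WithLp.toLp 2 fun i => x i

/-- The vector whose subvector on the block `blk ⁻¹' {j}` is `y j`. -/
def blockGlue (y : ∀ j, EuclideanSpace ℝ {i // blk i = j}) : EuclideanSpace ℝ ι :=
  WithLp.toLp 2 fun i => y (blk i) ⟨i, rfl⟩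

theorem blockProj_sub_blockGlue (x : EuclideanSpace ℝ ι)
    (y : ∀ j, EuclideanSpace ℝ {i // blk i = j}) (j : κ) :
    blockProj blk (x - blockGlue blk y) j = blockProj blk x j - y j := by
  ext ⟨i, rfl⟩
  rfl

variable [Fintype ι] [DecidableEq κ]

theorem norm_blockProj_le (x : EuclideanSpace ℝ ι) (j : κ) : ‖blockProj blk x j‖ ≤ ‖x‖ := by
  rw [← sq_le_sq₀ (norm_nonneg _) (norm_nonneg _), EuclideanSpace.real_norm_sq_eq,
    EuclideanSpace.real_norm_sq_eq]
  exact (Finset.sum_subtype {i | blk i = j} (by simp) fun i => x i ^ 2).symm.trans_le <|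
    Finset.sum_le_sum_of_subset_of_nonneg (Finset.filter_subset _ _) fun _ _ _ => sq_nonneg _

variable [Fintype κ]

theorem sum_norm_sq_blockProj (x : EuclideanSpace ℝ ι) :
    ∑ j, ‖blockProj blk x j‖ ^ 2 = ‖x‖ ^ 2 := by
  simp only [EuclideanSpace.real_norm_sq_eq]
  exact Fintype.sum_fiberwise blk fun i => x i ^ 2

theorem prod_pow_card_block {M : Type*} [CommMonoid M] (f : κ → M) :
    ∏ j, f j ^ Fintype.card {i // blk i = j} = ∏ i, f (blk i) := by
  simp only [← Fintype.prod_fiberwise blk, ← Finset.card_univ, ← Finset.prod_const]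
  exact Finset.prod_congr rfl fun j _ => Finset.prod_congr rfl fun i _ => by rw [i.2]

end Blocks

section LevelRounding

open Real

theorem abs_le_mul_exp_posLog_div {ε : ℝ} (hε : 0 < ε) (x : ℝ) :
    |x| ≤ ε * exp (log⁺ (x / ε)) := by
  rw [← posLog_abs, posLog_eq_log_max_one (abs_nonneg _), exp_log (by positivity), abs_div,
    abs_of_pos hε, ← div_le_iff₀' hε]
  exact le_max_right _ _

theorem mul_ceil_posLog_div_le {h : ℝ} (hh : 0 < h) (y : ℝ) :
    h * ⌈log⁺ y / h⌉₊ ≤ log⁺ y + if 1 < |y| then h else 0 := by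
  split_ifs with hy
  · calc h * ⌈log⁺ y / h⌉₊ ≤ h * (log⁺ y / h + 1) := by
          gcongr
          exact (Nat.ceil_lt_add_one (div_nonneg posLog_nonneg hh.le)).le
      _ = log⁺ y + h := by field_simp
  · simp [(posLog_eq_zero_iff y).2 (not_lt.1 hy)]

variable {ι : Type*} [Fintype ι]

theorem sum_mul_ceil_posLog_div_le (τ : ι → ℝ) {ε h : ℝ} (hε : 0 < ε) (hh : 0 < h) :
    ∑ i, h * (⌈log⁺ (τ i / ε) / h⌉₊ : ℝ) ≤
      ∑ i, log⁺ (τ i / ε) + h * Finset.card {i | ε < |τ i|} := by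
  refine (Finset.sum_le_sum fun i _ => mul_ceil_posLog_div_le hh (τ i / ε)).trans_eq ?_
  simp only [abs_div, abs_of_pos hε, one_lt_div hε]
  rw [Finset.sum_add_distrib, ← Finset.sum_filter, Finset.sum_const, nsmul_eq_mul, mul_comm h]

theorem card_range_ceil_le {f : ι → ℝ} {L : ℝ} (hL : 0 ≤ L) (hf : ∀ i, f i ≤ L) :
    (Fintype.card (Set.range fun i => ⌈f i⌉₊) : ℝ) ≤ L + 2 := by
  have hsub : (Set.range fun i => ⌈f i⌉₊) ⊆ Finset.range (⌈L⌉₊ + 1) := by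
    rintro _ ⟨i, rfl⟩
    exact Finset.mem_coe.2 (Finset.mem_range_succ_iff.2 (Nat.ceil_mono (hf i)))
  have hcard : Fintype.card (Set.range fun i => ⌈f i⌉₊) ≤ ⌈L⌉₊ + 1 := by
    simpa using Set.card_le_card hsub
  have hceil : (⌈L⌉₊ : ℝ) < L + 1 := Nat.ceil_lt_add_one hL
  have hcard' : (Fintype.card (Set.range fun i => ⌈f i⌉₊) : ℝ) ≤ ⌈L⌉₊ + 1 := by
    exact_mod_cast hcard
  linarith

end LevelRounding

section EllipsoidCover

variable {ι κ : Type*} [Fintype ι] [DecidableEq ι]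

open Module Real

/-- The diagonal operator `x ↦ (τ i * x i)ᵢ` on Euclidean space; it maps the unit ball onto the
ellipsoid with semi-axes `τ`. -/
noncomputable def diagScale (τ : ι → ℝ) : EuclideanSpace ℝ ι →L[ℝ] EuclideanSpace ℝ ι :=
  Matrix.toEuclideanCLM (𝕜 := ℝ) (Matrix.diagonal τ)

theorem diagScale_apply (τ : ι → ℝ) (x : EuclideanSpace ℝ ι) (i : ι) :
    diagScale τ x i = τ i * x i :=
  Matrix.mulVec_diagonal τ x.ofLp i

variable {blk : ι → κ} {τ : ι → ℝ} {b : κ → ℝ}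

theorem norm_blockProj_diagScale_le [DecidableEq κ] (hb0 : ∀ j, 0 ≤ b j)
    (hτb : ∀ i, |τ i| ≤ b (blk i)) (x : EuclideanSpace ℝ ι) (j : κ) :
    ‖blockProj blk (diagScale τ x) j‖ ≤ b j * ‖blockProj blk x j‖ := by
  rw [← sq_le_sq₀ (norm_nonneg _) (mul_nonneg (hb0 j) (norm_nonneg _)), mul_pow,
    EuclideanSpace.real_norm_sq_eq, EuclideanSpace.real_norm_sq_eq, Finset.mul_sum]
  refine Finset.sum_le_sum fun ⟨i, hi⟩ _ => ?_
  calc diagScale τ x i ^ 2 = |τ i| ^ 2 * x i ^ 2 := by rw [diagScale_apply, mul_pow, sq_abs]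
    _ ≤ b j ^ 2 * x i ^ 2 := by
      gcongr
      exact hi ▸ hτb i

variable [Fintype κ]

theorem exists_cover_diagScale_of_isDilationCover [DecidableEq κ] (hb0 : ∀ j, 0 ≤ b j)
    (hτb : ∀ i, |τ i| ≤ b (blk i)) {G : ∀ j, Finset (EuclideanSpace ℝ {i // blk i = j})}
    {e t : ℝ} (hG : ∀ j, IsDilationCover (G j) (b j) e t) :
    ∃ C : Finset (EuclideanSpace ℝ ι),
      (∀ x : EuclideanSpace ℝ ι, ‖x‖ ≤ 1 →
        ∃ c ∈ C, ‖diagScale τ x - c‖ ^ 2 ≤ (1 + Fintype.card κ * t) * e ^ 2) ∧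
      C.card ≤ ∏ j, (G j).card := by
  classical
  refine ⟨(Fintype.piFinset G).image (blockGlue blk), fun x hx => ?_,
    Finset.card_image_le.trans_eq (Fintype.card_piFinset G)⟩
  choose y hyG hy using fun j => hG j _ ⟨norm_nonneg _, (norm_blockProj_le blk x j).trans hx⟩ _
    (norm_blockProj_diagScale_le hb0 hτb x j)
  refine ⟨_, Finset.mem_image_of_mem _ (Fintype.mem_piFinset.2 hyG), ?_⟩
  calc ‖diagScale τ x - blockGlue blk y‖ ^ 2
      = ∑ j, ‖blockProj blk (diagScale τ x) j - y j‖ ^ 2 := by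
        simp only [← sum_norm_sq_blockProj blk (_ - _), blockProj_sub_blockGlue]
    _ ≤ ∑ j, (‖blockProj blk x j‖ ^ 2 + t) * e ^ 2 := Finset.sum_le_sum fun j _ => hy j
    _ = (‖x‖ ^ 2 + Fintype.card κ * t) * e ^ 2 := by
        rw [← Finset.sum_mul, Finset.sum_add_distrib, sum_norm_sq_blockProj, Finset.sum_const,
          Finset.card_univ, nsmul_eq_mul]
    _ ≤ (1 + Fintype.card κ * t) * e ^ 2 := by
        gcongr
        exact pow_le_one₀ (norm_nonneg x) hx

theorem sqrt_one_add_one_div_pow_le_exp_one (d : ℕ) : √(1 + 1 / (d : ℝ)) ^ d ≤ exp 1 := by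
  have hd0 : (0 : ℝ) ≤ 1 / d := by positivity
  have hsqrt : √(1 + 1 / (d : ℝ)) ≤ exp (1 / d) :=
    (sqrt_le_iff.2 ⟨by positivity, by nlinarith⟩ : _ ≤ 1 + 1 / (d : ℝ)).trans
      ((add_comm _ _).trans_le (add_one_le_exp _))
  calc √(1 + 1 / (d : ℝ)) ^ d ≤ exp (1 / d) ^ d := by gcongr
    _ = exp (d * (1 / d)) := (exp_nat_mul _ _).symm
    _ ≤ exp 1 := exp_le_exp.2 (by rw [mul_one_div]; exact div_self_le_one _)

theorem exists_cover_diagScale_card_le_prod {ε : ℝ} (hε : 0 < ε) (hb : ∀ j, ε ≤ b j)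
    (hτb : ∀ i, |τ i| ≤ b (blk i)) (hκ : Fintype.card κ ≤ Fintype.card ι)
    (hι : 2 ≤ Fintype.card ι) :
    ∃ C : Finset (EuclideanSpace ℝ ι),
      (∀ x : EuclideanSpace ℝ ι, ‖x‖ ≤ 1 → ∃ c ∈ C, ‖diagScale τ x - c‖ ≤ ε) ∧
      (C.card : ℝ) ≤ ((Fintype.card ι : ℝ) ^ 15) ^ Fintype.card κ *
        (exp 1 * ∏ i, b (blk i) / ε) := by
  classical
  set d := Fintype.card ι
  have : (0 : ℝ) < d := by exact_mod_cast two_pos.trans_le hι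
  set a := √(1 + 1 / (d : ℝ))
  have ha2 : a ^ 2 = 1 + 1 / d := sq_sqrt (by positivity)
  have ha1 : 1 < a := lt_sqrt_of_sq_lt <| by
    rw [one_pow, lt_add_iff_pos_right]
    positivity
  have ha0 : 0 < a := by positivity
  have hb0 : ∀ j, 0 ≤ b j := fun j => hε.le.trans (hb j)
  choose G hG hGcard using fun j => exists_isDilationCover_card_le_pow
    (E := EuclideanSpace ℝ {i // blk i = j}) (div_pos hε ha0)
    ((div_lt_self hε ha1).trans_le (hb j)) hι
    (finrank_euclideanSpace.trans_le (Fintype.card_subtype_le _))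
  obtain ⟨C, hC, hCcard⟩ := exists_cover_diagScale_of_isDilationCover hb0 hτb hG
  refine ⟨C, fun x hx => ?_, ?_⟩
  · obtain ⟨c, hc, hxc⟩ := hC x hx
    refine ⟨c, hc, (sq_le_sq₀ (norm_nonneg _) hε.le).1 (hxc.trans ?_)⟩
    calc (1 + Fintype.card κ * (1 / (d : ℝ) ^ 2)) * (ε / a) ^ 2
        ≤ (1 + d * (1 / (d : ℝ) ^ 2)) * (ε / a) ^ 2 := by gcongr
      _ = (1 + 1 / d) * (ε ^ 2 / a ^ 2) := by
          field_simp
      _ = ε ^ 2 := by rw [ha2]; field_simp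
  · have hprod0 : 0 ≤ ∏ i, b (blk i) / ε := Finset.prod_nonneg fun i _ => div_nonneg (hb0 _) hε.le
    calc (C.card : ℝ) ≤ ∏ j, ((G j).card : ℝ) := by exact_mod_cast hCcard
      _ ≤ ∏ j, ((d : ℝ) ^ 15 * (b j / (ε / a)) ^ Fintype.card {i // blk i = j}) :=
          Finset.prod_le_prod (fun j _ => Nat.cast_nonneg _) fun j _ => (hGcard j).trans_eq <| by
            rw [finrank_euclideanSpace]
      _ = ((d : ℝ) ^ 15) ^ Fintype.card κ * ∏ i, b (blk i) / (ε / a) := by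
          rw [Finset.prod_mul_distrib, Finset.prod_const, Finset.card_univ,
            prod_pow_card_block blk fun j => b j / (ε / a)]
      _ = ((d : ℝ) ^ 15) ^ Fintype.card κ * (a ^ d * ∏ i, b (blk i) / ε) := by
          simp only [div_div_eq_mul_div, mul_comm _ a, mul_div_assoc, Finset.prod_mul_distrib,
            Finset.prod_const, Finset.card_univ, d]
      _ ≤ _ := by
          gcongr
          exact sqrt_one_add_one_div_pow_le_exp_one d

theorem exists_cover_diagScale_log_card_le_of_step {ε h L : ℝ} (hε : 0 < ε) (hh : 0 < h)
    (hL : 0 ≤ L) (hτL : ∀ i, log⁺ (τ i / ε) ≤ L) (hι : 2 ≤ Fintype.card ι) :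
    ∃ C : Finset (EuclideanSpace ℝ ι),
      (∀ x : EuclideanSpace ℝ ι, ‖x‖ ≤ 1 → ∃ c ∈ C, ‖diagScale τ x - c‖ ≤ ε) ∧
      log C.card ≤ 15 * (L / h + 2) * log (Fintype.card ι) + 1 +
        (∑ i, log⁺ (τ i / ε) + h * Finset.card {i | ε < |τ i|}) := by
  classical
  set lev : ι → ℕ := fun i => ⌈log⁺ (τ i / ε) / h⌉₊
  have hlev : (Fintype.card (Set.range lev) : ℝ) ≤ L / h + 2 :=
    card_range_ceil_le (div_nonneg hL hh.le) fun i => div_le_div_of_nonneg_right (hτL i) hh.le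
  have hb (k : Set.range lev) : ε ≤ ε * exp (h * k) :=
    le_mul_of_one_le_right hε.le (one_le_exp (by positivity))
  have hτb (i : ι) : |τ i| ≤ ε * exp (h * Set.rangeFactorization lev i) :=
    (abs_le_mul_exp_posLog_div hε (τ i)).trans <| by
      gcongr
      exact (div_le_iff₀' hh).1 (Nat.le_ceil _)
  obtain ⟨C, hC, hcard⟩ := exists_cover_diagScale_card_le_prod hε hb hτb
    (Fintype.card_le_of_surjective _ Set.rangeFactorization_surjective) hι
  obtain ⟨c₀, hc₀, -⟩ := hC 0 (by simp)
  have hCpos : (0 : ℝ) < C.card := Nat.cast_pos.2 (Finset.card_pos.2 ⟨c₀, hc₀⟩)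
  have hprod : ∏ i, ε * exp (h * Set.rangeFactorization lev i) / ε = exp (∑ i, h * lev i) := by
    simp only [mul_div_cancel_left₀ _ hε.ne', exp_sum, Set.rangeFactorization_coe]
  rw [hprod, ← exp_add, ← pow_mul] at hcard
  refine ⟨C, hC, ?_⟩
  calc log C.card ≤ (15 * Fintype.card (Set.range lev) : ℕ) * log (Fintype.card ι) +
        (1 + ∑ i, h * lev i) := by
        rw [← log_pow, ← log_exp (1 + _), ← log_mul (by positivity) (by positivity)]
        exact log_le_log hCpos hcard
    _ ≤ 15 * (L / h + 2) * log (Fintype.card ι) + (1 + ∑ i, h * lev i) := by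
        push_cast
        gcongr
    _ ≤ _ := by
        rw [add_assoc _ 1]
        gcongr
        exact sum_mul_ceil_posLog_div_le τ hε hh

-- The step `h = √(L log d / m)` balances the cost `(L / h) log d` of the number of blocks against
-- the cost `m h` of rounding the semi-axes up.
theorem exists_cover_diagScale_log_card_le {ε t : ℝ} (hε : 0 < ε) (hτ : ∀ i, |τ i| ≤ t)
    (hι : 2 ≤ Fintype.card ι) :
    ∃ C : Finset (EuclideanSpace ℝ ι),
      (∀ x : EuclideanSpace ℝ ι, ‖x‖ ≤ 1 → ∃ c ∈ C, ‖diagScale τ x - c‖ ≤ ε) ∧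
      log C.card ≤ ∑ i, log⁺ (τ i / ε) + 32 * (log (Fintype.card ι) +
        √(log (t / ε) * log (Fintype.card ι) * Finset.card {i | ε < |τ i|})) := by
  set m := Finset.card {i | ε < |τ i|} with hm
  set ld := log (Fintype.card ι)
  set L := log (t / ε)
  have hld : 1 / 2 ≤ ld :=
    (by linarith [log_two_gt_d9] : 1 / 2 ≤ log 2).trans
      (log_le_log two_pos (by exact_mod_cast hι))
  rcases Nat.eq_zero_or_pos m with hm0 | hmpos
  · have hsmall (i : ι) : log⁺ (τ i / ε) ≤ 0 := by
      refine ((posLog_eq_zero_iff _).2 ?_).le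
      rw [abs_div, abs_of_pos hε, div_le_one hε]
      exact not_lt.1 (Finset.filter_eq_empty_iff.1 (Finset.card_eq_zero.1 hm0) (Finset.mem_univ i))
    obtain ⟨C, hC, hcard⟩ :=
      exists_cover_diagScale_log_card_le_of_step hε one_pos le_rfl hsmall hι
    refine ⟨C, hC, hcard.trans ?_⟩
    rw [← hm, hm0]
    norm_num
    linarith
  · obtain ⟨i₀, hi₀⟩ := Finset.card_pos.1 hmpos
    have hL : 0 < L :=
      log_pos ((one_lt_div hε).2 ((Finset.mem_filter.1 hi₀).2.trans_le (hτ i₀)))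
    have hτL (i : ι) : log⁺ (τ i / ε) ≤ L := by
      rw [← posLog_abs, abs_div, abs_of_pos hε]
      exact (posLog_le_posLog (by positivity) (div_le_div_of_nonneg_right (hτ i) hε.le)).trans
        (max_le hL.le le_rfl)
    have hm' : (0 : ℝ) < m := Nat.cast_pos.2 hmpos
    set Q := √(L * ld * m)
    have hQ : 0 < Q := sqrt_pos.2 (by positivity)
    have hQ2 : Q * Q = L * ld * m := mul_self_sqrt (by positivity)
    obtain ⟨C, hC, hcard⟩ :=
      exists_cover_diagScale_log_card_le_of_step hε (div_pos hQ hm') hL.le hτL hι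
    refine ⟨C, hC, hcard.trans ?_⟩
    have hblocks : L / (Q / m) * ld = Q := by
      rw [div_div_eq_mul_div, div_mul_eq_mul_div, div_eq_iff hQ.ne', hQ2]
      ring
    have hround : Q / m * m = Q := div_mul_cancel₀ _ hm'.ne'
    rw [← hm, hround]
    linarith

end EllipsoidCover

section ConvexProjection

variable {F : Type*} [NormedAddCommGroup F] [InnerProductSpace ℝ F]

theorem exists_mem_norm_sub_le_of_convex {K : Set F} (hconv : Convex ℝ K) (hcompl : IsComplete K)
    (hne : K.Nonempty) (c : F) : ∃ v ∈ K, ∀ z ∈ K, ‖z - v‖ ≤ ‖z - c‖ := by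
  obtain ⟨v, hv, hmin⟩ := exists_norm_eq_iInf_of_complete_convex hne hcompl hconv c
  refine ⟨v, hv, fun z hz => (sq_le_sq₀ (norm_nonneg _) (norm_nonneg _)).1 ?_⟩
  have hinner : inner ℝ (c - v) (z - v) ≤ 0 :=
    (norm_eq_iInf_iff_real_inner_le_zero hconv hv).1 hmin z hz
  calc ‖z - v‖ ^ 2 ≤ ‖z - v‖ ^ 2 - 2 * inner ℝ (c - v) (z - v) + ‖c - v‖ ^ 2 := by
        linarith [sq_nonneg ‖c - v‖]
    _ = ‖z - c‖ ^ 2 := by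
        rw [real_inner_comm, ← norm_sub_sq_real, sub_sub_sub_cancel_right]

theorem exists_finset_subset_of_cover_image {E : Type*} {T : E → F} {B : Set E} (hB : B.Nonempty)
    (hconv : Convex ℝ (T '' B)) (hcompl : IsComplete (T '' B)) {C : Finset F} {r : ℝ}
    (hC : ∀ x ∈ B, ∃ c ∈ C, ‖T x - c‖ ≤ r) :
    ∃ N : Finset E, ↑N ⊆ B ∧ N.card ≤ C.card ∧ ∀ x ∈ B, ∃ y ∈ N, ‖T x - T y‖ ≤ r := by
  classical
  have hproj (c : F) : ∃ y ∈ B, ∀ x ∈ B, ‖T x - T y‖ ≤ ‖T x - c‖ := by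
    simpa only [Set.exists_mem_image, Set.forall_mem_image] using
      exists_mem_norm_sub_le_of_convex hconv hcompl (hB.image T) c
  choose p hpB hp using hproj
  refine ⟨C.image p, ?_, Finset.card_image_le, fun x hx => ?_⟩
  · rw [Finset.coe_image, Set.image_subset_iff]
    exact fun c _ => hpB c
  · obtain ⟨c, hc, hxc⟩ := hC x hx
    exact ⟨p c, Finset.mem_image_of_mem p hc, (hp c x hx).trans hxc⟩

end ConvexProjection

section Spectrum

variable {d : ℕ} {S : Matrix (Fin d) (Fin d) ℝ}

theorem matrixNormSq_eq_sum_eigenvalues (hS : S.IsHermitian) (x : EuclideanSpace ℝ (Fin d)) :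
    matrixNormSq S x = ∑ i, hS.eigenvalues i * inner ℝ (hS.eigenvectorBasis i) x ^ 2 := by
  have hsymm : (S.toEuclideanLin).IsSymmetric := Matrix.isSymmetric_toEuclideanLin_iff.2 hS
  have hinner : matrixNormSq S x = inner ℝ x (S.toEuclideanLin x) := by
    rw [matrixNormSq, EuclideanSpace.inner_eq_star_dotProduct, dotProduct_comm]
    rfl
  rw [hinner, ← hS.eigenvectorBasis.sum_inner_mul_inner]
  refine Finset.sum_congr rfl fun i _ => ?_
  have heigen : S.toEuclideanLin (hS.eigenvectorBasis i) =
      hS.eigenvalues i • hS.eigenvectorBasis i :=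
    congrArg (WithLp.toLp 2) (hS.mulVec_eigenvectorBasis i)
  rw [← hsymm, heigen, real_inner_smul_left, real_inner_comm]
  ring

theorem exists_equiv_specScale_sq_eq_eigenvalues (hS : S.PosSemidef) :
    ∃ e : Fin d ≃ Fin d, ∀ i, specScale hS (e i) ^ 2 = hS.isHermitian.eigenvalues i :=
  ⟨(Fintype.equivOfCardEq (Fintype.card_fin _)).symm.trans (finCongr (Fintype.card_fin d)),
    fun i => Real.sq_sqrt (hS.eigenvalues_nonneg i)⟩

theorem exists_linearIsometryEquiv_matrixNormSq_eq (hS : S.PosSemidef) :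
    ∃ U : EuclideanSpace ℝ (Fin d) ≃ₗᵢ[ℝ] EuclideanSpace ℝ (Fin d),
      ∀ x, matrixNormSq S x = ‖diagScale (specScale hS) (U x)‖ ^ 2 := by
  obtain ⟨e, he⟩ := exists_equiv_specScale_sq_eq_eigenvalues hS
  refine ⟨(hS.isHermitian.eigenvectorBasis.reindex e).repr, fun x => ?_⟩
  rw [matrixNormSq_eq_sum_eigenvalues hS.isHermitian, EuclideanSpace.real_norm_sq_eq,
    ← Equiv.sum_comp e fun i => diagScale _ _ i ^ 2]
  simp only [diagScale_apply, OrthonormalBasis.repr_apply_apply, OrthonormalBasis.reindex_apply,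
    Equiv.symm_apply_apply, mul_pow, he]

theorem specScale_nonneg (hS : S.PosSemidef) (i : Fin d) : 0 ≤ specScale hS i :=
  Real.sqrt_nonneg _

theorem specScale_antitone (hS : S.PosSemidef) : Antitone (specScale hS) := fun i j hij =>
  Real.sqrt_le_sqrt (hS.isHermitian.eigenvalues₀_antitone (by simpa using hij))

variable [NeZero d]

theorem specScale_zero_pos (hS : S.PosSemidef) (hS0 : S ≠ 0) : 0 < specScale hS 0 := by
  refine (specScale_nonneg hS 0).lt_of_ne' fun h0 => hS0 ?_
  obtain ⟨e, he⟩ := exists_equiv_specScale_sq_eq_eigenvalues hS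
  refine hS.isHermitian.eigenvalues_eq_zero_iff.1 (funext fun i => ?_)
  have hle : specScale hS (e i) ≤ 0 := h0 ▸ specScale_antitone hS (Fin.zero_le (e i))
  rw [← he, hle.antisymm (specScale_nonneg hS _)]
  simp

theorem largeCount_eq_card_filter (hS : S.PosSemidef) (ε : ℝ) :
    largeCount hS ε = Finset.card {i | ε * specScale hS 0 < specScale hS i} := by
  rw [largeCount, Nat.card_eq_fintype_card, Fintype.card_subtype]

theorem val_lt_largeCount_iff (hS : S.PosSemidef) (ε : ℝ) (i : Fin d) :
    i.val < largeCount hS ε ↔ ε * specScale hS 0 < specScale hS i := by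
  have hlower : IsLowerSet {i | ε * specScale hS 0 < specScale hS i} := fun i j hji hi =>
    lt_of_lt_of_le hi (specScale_antitone hS hji)
  rw [largeCount_eq_card_filter]
  constructor
  · contrapose!
    intro hi
    rw [← Fin.card_Iio i]
    refine Finset.card_le_card fun j hj => Finset.mem_Iio.2 (not_le.1 fun hij => ?_)
    exact hi.not_gt (hlower hij (Finset.mem_filter.1 hj).2)
  · intro hi
    rw [← Nat.succ_le_iff, Nat.succ_eq_add_one, ← Fin.card_Iic i]
    exact Finset.card_le_card fun j hj =>
      Finset.mem_filter.2 ⟨Finset.mem_univ _, hlower (Finset.mem_Iic.1 hj) hi⟩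

open Real

theorem entropyBound_eq_sum_posLog (hS : S.PosSemidef) (hS0 : S ≠ 0) (c : ℝ) {ε : ℝ}
    (hε : 0 < ε) :
    entropyBound hS c ε =
      ∑ i, log⁺ (specScale hS i / (ε * specScale hS 0)) + entropyRemainder hS c ε := by
  have hη : 0 < ε * specScale hS 0 := mul_pos hε (specScale_zero_pos hS hS0)
  rw [entropyBound, Finset.sum_filter]
  congr 1
  refine Finset.sum_congr rfl fun i _ => ?_
  have habs : |specScale hS i / (ε * specScale hS 0)| = specScale hS i / (ε * specScale hS 0) :=
    abs_of_nonneg (div_nonneg (specScale_nonneg hS i) hη.le)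
  split_ifs with hi <;> rw [val_lt_largeCount_iff] at hi
  · exact (posLog_eq_log (by rw [habs, one_le_div hη]; exact hi.le)).symm
  · exact ((posLog_eq_zero_iff _).2 (by rwa [habs, div_le_one hη, ← not_lt])).symm

theorem exists_net_matrixNormSq (hd : 2 ≤ d) (hS : S.PosSemidef) (hS0 : S ≠ 0) {ε : ℝ}
    (hε : 0 < ε) :
    ∃ N : Finset (EuclideanSpace ℝ (Fin d)),
      (∀ y ∈ N, y ∈ Metric.closedBall (0 : EuclideanSpace ℝ (Fin d)) 1) ∧
      (∀ x ∈ Metric.closedBall (0 : EuclideanSpace ℝ (Fin d)) 1, ∃ y ∈ N,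
        matrixNormSq S (x - y) ≤ ε ^ 2 * specScale hS 0 ^ 2) ∧
      log N.card ≤ entropyBound hS 32 ε := by
  set σ := specScale hS
  have hσ0 : 0 < σ 0 := specScale_zero_pos hS hS0
  have hσabs (i : Fin d) : |σ i| = σ i := abs_of_nonneg (specScale_nonneg hS i)
  obtain ⟨U, hU⟩ := exists_linearIsometryEquiv_matrixNormSq_eq hS
  obtain ⟨C, hC, hCcard⟩ := exists_cover_diagScale_log_card_le (τ := σ) (t := σ 0)
    (mul_pos hε hσ0) (fun i => (hσabs i).trans_le (specScale_antitone hS (Fin.zero_le i)))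
    (by rwa [Fintype.card_fin])
  let T : EuclideanSpace ℝ (Fin d) →L[ℝ] EuclideanSpace ℝ (Fin d) :=
    (diagScale σ).comp (U.toContinuousLinearEquiv : _ →L[ℝ] _)
  let B := Metric.closedBall (0 : EuclideanSpace ℝ (Fin d)) 1
  obtain ⟨N, hNB, hNC, hN⟩ := exists_finset_subset_of_cover_image (T := T) (B := B) (C := C)
    (r := ε * σ 0) (Metric.nonempty_closedBall.2 zero_le_one)
    ((convex_closedBall 0 1).linear_image T.toLinearMap)
    ((isCompact_closedBall 0 1).image T.continuous).isComplete
    fun x hx => hC (U x) ((U.norm_map x).trans_le (mem_closedBall_zero_iff.1 hx))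
  refine ⟨N, hNB, fun x hx => ?_, ?_⟩
  · obtain ⟨y, hy, hxy⟩ := hN x hx
    refine ⟨y, hy, ?_⟩
    rw [hU, ← mul_pow]
    exact pow_le_pow_left₀ (norm_nonneg _) ((congrArg norm (map_sub T x y)).trans_le hxy) 2
  · obtain ⟨y₀, hy₀, -⟩ := hN 0 (Metric.mem_closedBall_self zero_le_one)
    have hlog : log N.card ≤ log C.card :=
      log_le_log (Nat.cast_pos.2 (Finset.card_pos.2 ⟨y₀, hy₀⟩)) (Nat.cast_le.2 hNC)
    refine (hlog.trans hCcard).trans_eq ?_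
    simp only [hσabs, entropyBound_eq_sum_posLog hS hS0 32 hε, entropyRemainder,
      largeCount_eq_card_filter, Fintype.card_fin, div_mul_cancel_right₀ hσ0.ne', σ]

end Spectrum

section PosLogSum

open Real

theorem posLog_le_div_add {s y : ℝ} (hs : exp 1 ≤ s) (hy : 0 ≤ y) :
    log⁺ y ≤ y / s + (log s - 1) := by
  have hs0 : 0 < s := (exp_pos 1).trans_le hs
  have hlogs : 1 ≤ log s := (le_log_iff_exp_le hs0).2 hs
  have hys : 0 ≤ y / s := div_nonneg hy hs0.le
  refine max_le (by linarith) ?_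
  rcases hy.eq_or_lt with rfl | hy0
  · simpa using hlogs
  · have htangent := log_le_sub_one_of_pos (div_pos hy0 hs0)
    rw [log_div hy0.ne' hs0.ne'] at htangent
    linarith

theorem div_max_exp_add_mul_log_max_exp {A n : ℝ} (hn : 0 < n) :
    A / max (exp 1) (A / n) + n * (log (max (exp 1) (A / n)) - 1) =
      min n (A / exp 1) * log (max (exp 1) (A / n)) := by
  have hcomm : A / n ≤ exp 1 ↔ A / exp 1 ≤ n := by
    rw [div_le_iff₀ hn, div_le_iff₀' (exp_pos 1)]
  rcases le_total (A / n) (exp 1) with h | h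
  · rw [max_eq_left h, log_exp, min_eq_right (hcomm.1 h)]
    ring
  · have hA : A ≠ 0 := by
      rintro rfl
      exact (exp_pos 1).not_ge (by simpa using h)
    have hmin : n ≤ A / exp 1 := by
      rwa [le_div_iff₀ hn, ← le_div_iff₀' (exp_pos 1)] at h
    rw [max_eq_right h, min_eq_left hmin, div_div_cancel₀ hA]
    ring

theorem sum_posLog_le_min_mul_log {α : Type*} {s : Finset α} (hs : s.Nonempty) {y : α → ℝ}
    (hy : ∀ i ∈ s, 0 ≤ y i) :
    ∑ i ∈ s, log⁺ (y i) ≤ min (s.card : ℝ) ((∑ i ∈ s, y i) / exp 1) *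
      log (max (exp 1) ((∑ i ∈ s, y i) / s.card)) := by
  rw [← div_max_exp_add_mul_log_max_exp (Nat.cast_pos.2 hs.card_pos), Finset.sum_div,
    ← nsmul_eq_mul, ← Finset.sum_const, ← Finset.sum_add_distrib]
  exact Finset.sum_le_sum fun i hi => posLog_le_div_add (le_max_left _ _) (hy i hi)

theorem posLog_rpow {x p : ℝ} (hx : 0 ≤ x) (hp : 0 ≤ p) : log⁺ (x ^ p) = p * log⁺ x := by
  rcases hx.eq_or_lt with rfl | hx0
  · rcases hp.eq_or_lt with rfl | hp0
    · simp
    · simp [zero_rpow hp0.ne']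
  · rw [posLog_apply, posLog_apply, log_rpow hx0, mul_max_of_nonneg _ _ hp, mul_zero]

theorem card_filter_lt_le_sum_div_rpow {α : Type*} {s : Finset α} {f : α → ℝ}
    (hf : ∀ i ∈ s, 0 ≤ f i) {η p : ℝ} (hη : 0 < η) (hp : 0 ≤ p) :
    (Finset.card {i ∈ s | η < f i} : ℝ) ≤ ∑ i ∈ s, (f i / η) ^ p := by
  rw [Finset.card_filter, Nat.cast_sum]
  refine Finset.sum_le_sum fun i hi => ?_
  split_ifs with h
  · exact_mod_cast one_le_rpow ((one_le_div hη).2 h.le) hp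
  · exact_mod_cast rpow_nonneg (div_nonneg (hf i hi) hη.le) p

end PosLogSum

section EffectiveDimension

open Real

variable {d : ℕ} [NeZero d] {S : Matrix (Fin d) (Fin d) ℝ}

/-- The effective dimension `d_eff(r)` as a function of the real exponent `p = 2 / r`. -/
noncomputable def effDimRpow (hS : S.PosSemidef) (p : ℝ) : ℝ :=
  ∑ i, (specScale hS i / specScale hS 0) ^ p

theorem rpow_neg_mul_effDimRpow_sub_one (hS : S.PosSemidef) (hS0 : S ≠ 0) {ε : ℝ} (hε : 0 ≤ ε)
    (p : ℝ) :
    ε ^ (-p) * (effDimRpow hS p - 1) =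
      ∑ i ∈ Finset.univ.erase 0, (specScale hS i / (ε * specScale hS 0)) ^ p := by
  rw [effDimRpow, ← Finset.add_sum_erase _ _ (Finset.mem_univ (0 : Fin d)),
    div_self (specScale_zero_pos hS hS0).ne', one_rpow, add_sub_cancel_left, Finset.mul_sum]
  refine Finset.sum_congr rfl fun i _ => ?_
  rw [mul_comm ε, ← div_div, div_rpow _ hε, rpow_neg hε, inv_mul_eq_div]
  exact div_nonneg (specScale_nonneg hS i) (specScale_nonneg hS 0)

theorem largeCount_le_one_add_effDimRpow (hS : S.PosSemidef) (hS0 : S ≠ 0) {ε p : ℝ}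
    (hε : 0 < ε) (hp : 0 ≤ p) :
    (largeCount hS ε : ℝ) ≤ 1 + (effDimRpow hS p - 1) * ε ^ (-p) := by
  have hη : 0 < ε * specScale hS 0 := mul_pos hε (specScale_zero_pos hS hS0)
  rw [mul_comm, rpow_neg_mul_effDimRpow_sub_one hS hS0 hε.le, largeCount_eq_card_filter]
  have hcard : Finset.card {i | ε * specScale hS 0 < specScale hS i} ≤
      1 + Finset.card {i ∈ Finset.univ.erase 0 | ε * specScale hS 0 < specScale hS i} := by
    rw [Finset.filter_erase, add_comm]
    exact Nat.sub_le_iff_le_add.1 Finset.pred_card_le_card_erase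
  calc (Finset.card {i | ε * specScale hS 0 < specScale hS i} : ℝ) ≤ _ := Nat.cast_le.2 hcard
    _ ≤ _ := by
      rw [Nat.cast_add, Nat.cast_one]
      gcongr
      exact card_filter_lt_le_sum_div_rpow (fun i _ => specScale_nonneg hS i) hη hp

theorem sum_posLog_specScale_le (hd : 2 ≤ d) (hS : S.PosSemidef) (hS0 : S ≠ 0) {ε p : ℝ}
    (hε : 0 < ε) (hε1 : ε ≤ 1) (hp : 0 < p) :
    ∑ i, log⁺ (specScale hS i / (ε * specScale hS 0)) ≤ log ε⁻¹ +
      min ((d : ℝ) - 1) (ε ^ (-p) * ((effDimRpow hS p - 1) / exp 1)) / p *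
        log (max (exp 1) (ε ^ (-p) * ((effDimRpow hS p - 1) / ((d : ℝ) - 1)))) := by
  set y : Fin d → ℝ := fun i => specScale hS i / (ε * specScale hS 0)
  have hσ0 : 0 < specScale hS 0 := specScale_zero_pos hS hS0
  have hy (i : Fin d) : 0 ≤ y i := div_nonneg (specScale_nonneg hS i) (mul_pos hε hσ0).le
  have hfirst : log⁺ (y 0) = log ε⁻¹ := by
    have hy0 : y 0 = ε⁻¹ := div_mul_cancel_right₀ hσ0.ne' ε
    rw [hy0, posLog_eq_log]
    exact ((one_le_inv₀ hε).2 hε1).trans (le_abs_self _)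
  have hcard : ((Finset.univ.erase (0 : Fin d)).card : ℝ) = d - 1 := by
    rw [Finset.card_erase_of_mem (Finset.mem_univ _), Finset.card_fin, Nat.cast_pred (by omega)]
  have hne : (Finset.univ.erase (0 : Fin d)).Nonempty := by
    rw [← Finset.card_pos, Finset.card_erase_of_mem (Finset.mem_univ _), Finset.card_fin]
    omega
  have hrpow : ∑ i ∈ Finset.univ.erase 0, log⁺ (y i ^ p) ≤ _ :=
    sum_posLog_le_min_mul_log hne fun i _ => rpow_nonneg (hy i) p
  rw [hcard, ← rpow_neg_mul_effDimRpow_sub_one hS hS0 hε.le, mul_div_assoc, mul_div_assoc]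
    at hrpow
  rw [← Finset.add_sum_erase _ _ (Finset.mem_univ (0 : Fin d)), hfirst, div_mul_eq_mul_div]
  refine add_le_add_right ((le_div_iff₀' hp).2 ?_) _
  rw [Finset.mul_sum]
  exact (Finset.sum_congr rfl fun i _ => (posLog_rpow (hy i) hp.le).symm).trans_le hrpow

end EffectiveDimension

theorem corollary1_general :
    ∃ c : ℝ, 0 < c ∧
      ∀ (d : ℕ) [NeZero d], 2 ≤ d →
      ∀ (S : Matrix (Fin d) (Fin d) ℝ) (hS : S.PosSemidef), S ≠ 0 →
      ∀ ε : ℝ, 0 < ε →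
        (∃ N : Finset (EuclideanSpace ℝ (Fin d)),
          (∀ y ∈ N, y ∈ Metric.closedBall (0 : EuclideanSpace ℝ (Fin d)) 1) ∧
          (∀ x ∈ Metric.closedBall (0 : EuclideanSpace ℝ (Fin d)) 1, ∃ y ∈ N,
            matrixNormSq S (x - y) ≤ ε ^ 2 * specScale hS 0 ^ 2) ∧
          Real.log (N.card : ℝ) ≤ entropyBound hS c ε) ∧
        (∀ p : ℝ, 0 < p →
          (ε ≤ 1 →
            entropyBound hS c ε ≤
              Real.log ε⁻¹ +
                min ((d : ℝ) - 1) (ε ^ (-p) * ((effDimRpow hS p - 1) / Real.exp 1)) / p *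
                Real.log (max (Real.exp 1)
                  (ε ^ (-p) * ((effDimRpow hS p - 1) / ((d : ℝ) - 1)))) +
                entropyRemainder hS c ε) ∧
          (largeCount hS ε : ℝ) ≤ 1 + (effDimRpow hS p - 1) * ε ^ (-p)) := by
  refine ⟨32, by norm_num, fun d _ hd S hS hS0 ε hε =>
    ⟨exists_net_matrixNormSq hd hS hS0 hε, fun p hp =>
      ⟨fun hε1 => ?_, largeCount_le_one_add_effDimRpow hS hS0 hε hp.le⟩⟩⟩
  rw [entropyBound_eq_sum_posLog hS hS0 32 hε]
  exact add_le_add_left (sum_posLog_specScale_le hd hS hS0 hε hε1 hp) _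

theorem corollary1 :
    ∃ c : ℝ, 0 < c ∧
      ∀ (d : ℕ) [NeZero d], 2 ≤ d →
      ∀ (S : Matrix (Fin d) (Fin d) ℝ) (hS : S.PosDef)
        (Ω : Type*) [MeasurableSpace Ω] (P : Measure Ω) [IsProbabilityMeasure P]
        (a : Ω → EuclideanSpace ℝ (Fin d)), AEMeasurable a P → IsMatrixSubgaussian P S a →
      ∀ ε : ℝ, 0 < ε →
        -- the net of the unit ball, an `ε σ₁`-cover of the unit ball in the `S`-norm
        (∃ N : Finset (EuclideanSpace ℝ (Fin d)),
          (∀ y ∈ N, y ∈ Metric.closedBall (0 : EuclideanSpace ℝ (Fin d)) 1) ∧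
          (∀ x ∈ Metric.closedBall (0 : EuclideanSpace ℝ (Fin d)) 1, ∃ y ∈ N,
            matrixNormSq S (x - y) ≤ ε ^ 2 * specScale hS.posSemidef 0 ^ 2) ∧
          Real.log (N.card : ℝ) ≤ entropyBound hS.posSemidef c ε) ∧
        -- the bounds through the effective dimension
        (∀ r : ℕ, 1 ≤ r →
          (ε ≤ 1 →
            entropyBound hS.posSemidef c ε ≤
              Real.log ε⁻¹ +
                min ((d : ℝ) - 1)
                    (ε ^ (-(2 / (r : ℝ))) * ((effDim hS.posSemidef r - 1) / Real.exp 1)) /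
                  (2 / (r : ℝ)) *
                Real.log (max (Real.exp 1)
                  (ε ^ (-(2 / (r : ℝ))) * ((effDim hS.posSemidef r - 1) / ((d : ℝ) - 1)))) +
                entropyRemainder hS.posSemidef c ε) ∧
          (largeCount hS.posSemidef ε : ℝ) ≤
            1 + (effDim hS.posSemidef r - 1) * ε ^ (-(2 / (r : ℝ)))) := by
  obtain ⟨c, hc, h⟩ := corollary1_general
  exact ⟨c, hc, fun d _ hd S hS Ω _ P _ a _ _ ε hε =>
    (h d hd S hS.posSemidef hS.isUnit.ne_zero ε hε).imp_right fun hp r hr => hp _ (by positivity)⟩
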